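/- Let $0<r_i<r_e$, let $n\ge 1$ be an integer, and let $D=\{x\in\mathbb{R}^2:|x|<r_i\}$ and $\Omega=\{x\in\mathbb{R}^2:|x|<r_e\}$, with outward unit normal $\nu=x/|x|$ on their boundaries. In polar coordinates $(r,\theta)$, let $H=r^n e^{\mathrm{i}n\theta}$ be the background electrostatic potential and $P=12\,r^n e^{\mathrm{i}n\theta}$ the background pressure. For $\zeta_0\in\mathbb{R}$ consider the system for complex-valued $\varphi,p$ \[ \begin{cases} \Delta\varphi=0 & \text{in } \mathbb{R}^2\setminus\overline{D},\\ \partial\varphi/\partial\nu=0 & \text{on } \partial D,\\ \varphi=H+O(|x|^{-1}) & \text{as } |x|\to\infty,\\ \Delta p=0 & \text{in } \Omega\setminus\overline{D} \text{ and in } \mathbb{R}^2\setminus\overline{\Omega},\\ \partial p/\partial\nu=0 & \text{on } \partial D,\\ p|_+=p|_- & \text{on } \partial\Omega,\\ \frac{\partial p}{\partial\nu}\big|_+-\frac{\partial p}{\partial\nu}\big|_-=12\,\zeta_0\,\frac{\partial\varphi}{\partial\nu} & \text{on } \partial\Omega,\\ p=P+O(|x|^{-1}) & \text{as } |x|\to\infty,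 \end{cases} \] where $\frac{\partial f}{\partial\nu}\big|_\pm(x)=\lim_{t\to0^+}\langle\nabla f(x\pm t\nu(x)),\nu(x)\rangle$ (on $\partial D$ the normal derivative is taken from outside $D$). A classical solution is a pair $(\varphi,p)$ of functions continuous on $\mathbb{R}^2\setminus D$, with $\varphi$ of class $C^2$ in $\mathbb{R}^2\setminus\overline{D}$ and $p$ of class $C^2$ in $\Omega\setminus\overline{D}$ and in $\mathbb{R}^2\setminus\overline{\Omega}$, that satisfies this system. Let $\zeta_{mean}=\zeta_0$ in $\Omega\setminus\overline{D}$ and $\zeta_{mean}=0$ in $\mathbb{R}^2\setminus\overline{\Omega}$, let $u_{aver}=-\frac1{12}\nabla p-\zeta_{mean}\nabla\varphi$ be the depth-averaged velocity, and let $F=\int_{\partial D}(-p\,I)\,\nu\,ds$ be the hydrodynamic force on $D$. (1) (Perfect hydrodynamic cloaking.) If \[ \zeta_0=\frac{2r_i^{2n}r_e^{2n}}{r_e^{4n}-r_i^{4n}}, \] then the system has a classical solution, and every classical solution satisfies $p=P$ and $u_{aver}=-\nabla P/12$ in $\mathbb{R}^2\setminus\overline{\Omega}$. (2) (Perfect hydrodynamic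 shielding.) If \[ \zeta_0=\frac{2r_e^{2n}}{r_e^{2n}-r_i^{2n}}, \] then the system has a classical solution, and every classical solution satisfies $p=0$ in $\Omega\setminus\overline{D}$ and $F=0$. -/

import Mathlib

open Set Filter Topology Asymptotics MeasureTheory InnerProductSpace
open scoped MeasureTheory

/-! The plane is `ℂ`, regarded as a real Euclidean plane with coordinates `x₁ = re`, `x₂ = im`.
Scalar fields are complex-valued, so that `r ^ n * exp (i n θ)` is allowed as a background field;
vector fields take values in `ℂ²`, written `Fin 2 → ℂ`. -/

/-- The gradient `(∂f/∂x₁, ∂f/∂x₂)` of a complex-valued field on the plane. -/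
noncomputable def planeGrad (f : ℂ → ℂ) (x : ℂ) : Fin 2 → ℂ :=
  ![fderiv ℝ f x 1, fderiv ℝ f x Complex.I]

/-- `∂f/∂ν|₊ (x) = a`: the limit of `⟨∇f(x + t ν), ν⟩` as `t → 0⁺` is `a`. -/
def HasOuterNormalDeriv (f : ℂ → ℂ) (ν x : ℂ) (a : ℂ) : Prop :=
  Tendsto (fun t : ℝ => fderiv ℝ f (x + t • ν) ν) (𝓝[>] 0) (𝓝 a)

/-- `∂f/∂ν|₋ (x) = a`: the limit of `⟨∇f(x - t ν), ν⟩` as `t → 0⁺` is `a`. -/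
def HasInnerNormalDeriv (f : ℂ → ℂ) (ν x : ℂ) (a : ℂ) : Prop :=
  Tendsto (fun t : ℝ => fderiv ℝ f (x - t • ν) ν) (𝓝[>] 0) (𝓝 a)

/-- The zeta potential: `ζ₀` in the control region `Ω \ closure D`, and `0` outside `Ω`. -/
noncomputable def zetaMean (D Ω : Set ℂ) (ζ₀ : ℝ) : ℂ → ℝ :=
  (Ω \ closure D).indicator fun _ => ζ₀

/-- `(φ, p)` is a classical solution of the electro-osmosis system for the object `D`, the region
`Ω`, the zeta potential `ζ₀` and the background fields `H` and `P`. Here `νD` and `νΩ` are the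
outward unit normal fields on the boundaries of `D` and of `Ω`. The potential `φ` is `C²` outside
`closure D`, the pressure `p` is `C²` on either side of the interface `frontier Ω`, and both are
continuous outside `D`, which for `p` contains the transmission condition `p|₊ = p|₋`. -/
structure IsElectroOsmoticSolution (D Ω : Set ℂ) (νD νΩ : ℂ → ℂ) (ζ₀ : ℝ) (H P : ℂ → ℂ)
    (φ p : ℂ → ℂ) : Prop where
  potential_harmonic : HarmonicOnNhd φ (closure D)ᶜ
  potential_continuous : ContinuousOn φ Dᶜ
  potential_insulation : ∀ x ∈ frontier D, HasOuterNormalDeriv φ (νD x) x 0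
  potential_infinity :
    (fun x => φ x - H x) =O[Bornology.cobounded ℂ] fun x => (‖x‖⁻¹ : ℝ)
  pressure_harmonic_inside : HarmonicOnNhd p (Ω \ closure D)
  pressure_harmonic_outside : HarmonicOnNhd p (closure Ω)ᶜ
  pressure_continuous : ContinuousOn p Dᶜ
  pressure_no_penetration : ∀ x ∈ frontier D, HasOuterNormalDeriv p (νD x) x 0
  pressure_jump : ∀ x ∈ frontier Ω, ∃ a b : ℂ,
    HasOuterNormalDeriv p (νΩ x) x a ∧ HasInnerNormalDeriv p (νΩ x) x b ∧
      a - b = 12 * ζ₀ * fderiv ℝ φ x (νΩ x)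
  pressure_infinity :
    (fun x => p x - P x) =O[Bornology.cobounded ℂ] fun x => (‖x‖⁻¹ : ℝ)

/-- The depth-averaged velocity `-∇p / 12 - ζ_mean ∇φ`. -/
noncomputable def averageVelocity (D Ω : Set ℂ) (ζ₀ : ℝ) (φ p : ℂ → ℂ) (x : ℂ) : Fin 2 → ℂ :=
  -((1 / 12 : ℂ) • planeGrad p x) - (zetaMean D Ω ζ₀ x : ℂ) • planeGrad φ x

/-- The normalized stress tensor `σ = -p I`. -/
noncomputable def stressTensor (p : ℂ → ℂ) (x : ℂ) : Matrix (Fin 2) (Fin 2) ℂ :=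
  -(p x • (1 : Matrix (Fin 2) (Fin 2) ℂ))

/-- The depth-averaged force `∫_{∂D} σ ν ds` on the object `D`; the arc length on the boundary is
the one-dimensional Hausdorff measure. -/
noncomputable def hydrodynamicForce (D : Set ℂ) (νD : ℂ → ℂ) (p : ℂ → ℂ) : Fin 2 → ℂ :=
  ∫ y in frontier D, (stressTensor p y).mulVec ![((νD y).re : ℂ), ((νD y).im : ℂ)] ∂μH[1]

/-- The outward unit normal `x / |x|` on every circle centred at the origin. -/
noncomputable def radialNormal (x : ℂ) : ℂ := x / (‖x‖ : ℂ)

/-- The field `r ^ n * exp (i n θ)` in polar coordinates `x = r exp (i θ)`. -/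
noncomputable def polarHarmonic (n : ℕ) (x : ℂ) : ℂ :=
  (‖x‖ : ℂ) ^ n * Complex.exp (Complex.I * n * (x.arg : ℂ))

/-- The system for the concentric disks `D = {|x| < rᵢ}` and `Ω = {|x| < rₑ}` with the background
fields `H = r ^ n exp (i n θ)` and `P = 12 r ^ n exp (i n θ)`. -/
def IsAnnulusSolution (n : ℕ) (ri re ζ₀ : ℝ) (φ p : ℂ → ℂ) : Prop :=
  IsElectroOsmoticSolution (Metric.ball 0 ri) (Metric.ball 0 re) radialNormal radialNormal ζ₀
    (polarHarmonic n) (fun x => 12 * polarHarmonic n x) φ p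

/-! Separating variables, `φ` and `p` are combinations of `r ^ n exp (i n θ)` and
`r ^ (-n) exp (i n θ)` on each side of `|x| = rₑ`, and for every `ζ₀` the boundary and matching
conditions determine the coefficients. The two prescribed values of `ζ₀` are the zeros of the
decaying coefficient of `p` outside `Ω` and of the growing coefficient of `p` inside `Ω`.

Uniqueness is a maximum principle up to the Neumann circle and across the interface. Let `u` be a
real solution of the homogeneous transmission problem tending to `0` at infinity, and add
`ε max (|x|², 2|x|² - rₑ²)`. A local maximum of the sum is also a local maximum of the sum with
either piece of the barrier that is active at the point. Off the interface this contradicts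
subharmonicity, on `|x| = rᵢ` the outward radial derivative is positive, and on `|x| = rₑ` both
pieces would force the radial derivative of `u` to take two different values. So the sum is
controlled by its values far out, and `ε → 0` gives `u ≤ 0`. -/

section MaximumPrinciple

theorem deriv_deriv_nonpos_of_isLocalMax {g : ℝ → ℝ} {a : ℝ} (h : IsLocalMax g a)
    (hc : ContinuousAt g a) : deriv (deriv g) a ≤ 0 := by
  by_contra! hpos
  have hmin := isLocalMin_of_deriv_deriv_pos hpos h.deriv_eq_zero hc
  have hconst : g =ᶠ[𝓝 a] fun _ => g a := by
    filter_upwards [h, hmin] with t h₁ h₂ using le_antisymm h₁ h₂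
  have hzero : deriv (deriv g) a = 0 := by simpa using hconst.deriv.deriv_eq
  exact hpos.ne' hzero

theorem nonpos_of_isLocalMaxOn_Ici {g : ℝ → ℝ} {a g' : ℝ} (h : IsLocalMaxOn g (Ici a) a)
    (hg : HasDerivWithinAt g g' (Ici a) a) : g' ≤ 0 := by
  have hcone : (1 : ℝ) ∈ posTangentConeAt (Ici a) a :=
    mem_posTangentConeAt_of_segment_subset ((convex_Ici a).segment_subset self_mem_Ici (by simp))
  simpa using h.hasFDerivWithinAt_nonpos hg.hasFDerivWithinAt hcone

theorem deriv_deriv_comp_add_smul {E F : Type*} [NormedAddCommGroup E] [NormedSpace ℝ E]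
    [NormedAddCommGroup F] [NormedSpace ℝ F] {f : E → F} {x : E} (hf : ContDiffAt ℝ 2 f x)
    (e : E) :
    deriv (deriv fun t : ℝ => f (x + t • e)) 0 = iteratedFDeriv ℝ 2 f x ![e, e] := by
  have hline (t : ℝ) : HasDerivAt (fun t : ℝ => x + t • e) e t := by
    simpa using ((hasDerivAt_id t).smul_const e).const_add x
  have hx : Tendsto (fun t : ℝ => x + t • e) (𝓝 0) (𝓝 x) := by
    simpa [ContinuousAt] using (hline 0).continuousAt
  have hfirst : deriv (fun t : ℝ => f (x + t • e)) =ᶠ[𝓝 0] fun t => fderiv ℝ f (x + t • e) e := by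
    filter_upwards [hx.eventually (hf.eventually (by simp))] with t ht
    exact ((ht.differentiableAt (by simp)).hasFDerivAt.comp_hasDerivAt t (hline t)).deriv
  have hf' : HasFDerivAt (fderiv ℝ f) (fderiv ℝ (fderiv ℝ f) x) (x + (0 : ℝ) • e) := by
    simpa using ((hf.fderiv_right (m := 1) (by norm_num)).differentiableAt (by simp)).hasFDerivAt
  have hsecond : HasDerivAt (fun t : ℝ => fderiv ℝ f (x + t • e)) (fderiv ℝ (fderiv ℝ f) x e) 0 :=
    hf'.comp_hasDerivAt (f := fun t : ℝ => x + t • e) 0 (hline 0)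
  rw [hfirst.deriv_eq, (hsecond.clm_apply (hasDerivAt_const 0 e)).deriv, iteratedFDeriv_two_apply]
  simp

variable {E : Type*} [NormedAddCommGroup E] [InnerProductSpace ℝ E] [FiniteDimensional ℝ E]

theorem laplacian_nonpos_of_isLocalMax {f : E → ℝ} {x : E} (h : IsLocalMax f x)
    (hf : ContDiffAt ℝ 2 f x) : Laplacian.laplacian f x ≤ 0 := by
  rw [laplacian_eq_iteratedFDeriv_stdOrthonormalBasis]
  refine Finset.sum_nonpos fun i _ => ?_
  rw [← deriv_deriv_comp_add_smul hf]
  have hline : Tendsto (fun t : ℝ => x + t • stdOrthonormalBasis ℝ E i) (𝓝 0)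
      (𝓝 (x + (0 : ℝ) • stdOrthonormalBasis ℝ E i)) := Continuous.tendsto (by fun_prop) 0
  rw [← add_zero x, ← zero_smul ℝ (stdOrthonormalBasis ℝ E i)] at h hf
  exact deriv_deriv_nonpos_of_isLocalMax
    (IsMaxFilter.comp_tendsto (g := fun t : ℝ => x + t • stdOrthonormalBasis ℝ E i) h hline)
    (hf.continuousAt.tendsto.comp hline)

theorem laplacian_norm_sq (x : E) :
    Laplacian.laplacian (fun z : E => ‖z‖ ^ 2) x = 2 * Module.finrank ℝ E := by
  have hsecond : fderiv ℝ (fderiv ℝ fun z : E => ‖z‖ ^ 2) x = 2 • innerSL ℝ (E := E) := by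
    rw [fderiv_norm_sq]
    exact ((2 : ℕ) • innerSL ℝ (E := E) : E →L[ℝ] E →L[ℝ] ℝ).fderiv
  have hquad (e : E) : fderiv ℝ (fderiv ℝ fun z : E => ‖z‖ ^ 2) x e e = 2 * ‖e‖ ^ 2 := by
    rw [hsecond, ← real_inner_self_eq_norm_sq, two_nsmul, two_mul]
    rfl
  rw [laplacian_eq_iteratedFDeriv_stdOrthonormalBasis]
  simp [iteratedFDeriv_two_apply, hquad, mul_comm]

theorem not_isLocalMax_add_norm_sq [Nontrivial E] {u : E → ℝ} {x : E} (hu : HarmonicAt u x)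
    {k : ℝ} (hk : 0 < k) : ¬IsLocalMax (fun z => u z + k * ‖z‖ ^ 2) x := by
  intro h
  have hsq : ContDiffAt ℝ 2 (fun z : E => ‖z‖ ^ 2) x := (contDiff_norm_sq ℝ).contDiffAt
  have hsq' : ContDiffAt ℝ 2 (k • fun z : E => ‖z‖ ^ 2) x := hsq.const_smul k
  have hnonpos := laplacian_nonpos_of_isLocalMax (f := u + k • fun z : E => ‖z‖ ^ 2) h
    (hu.1.add hsq')
  rw [hu.1.laplacian_add hsq', laplacian_smul k hsq, hu.2.self_of_nhds] at hnonpos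
  simp only [Pi.zero_apply, laplacian_norm_sq, zero_add, smul_eq_mul] at hnonpos
  have hdim : (0 : ℝ) < Module.finrank ℝ E := mod_cast Module.finrank_pos
  exact hnonpos.not_gt (by positivity)

theorem exists_norm_eq_le_of_not_isLocalMaxOn {E : Type*} [NormedAddCommGroup E] [ProperSpace E]
    {S : Set E} (hS : IsClosed S) {u : E → ℝ} (hu : ContinuousOn u S)
    (hmax : ∀ y ∈ S, ¬IsLocalMaxOn u S y) {x : E} (hx : x ∈ S) {R : ℝ} (hR : ‖x‖ ≤ R) :
    ∃ y ∈ S, ‖y‖ = R ∧ u x ≤ u y := by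
  obtain ⟨y, ⟨hyS, hyR⟩, hy⟩ := ((isCompact_closedBall 0 R).inter_left hS).exists_isMaxOn
    ⟨x, hx, by simpa using hR⟩ (hu.mono inter_subset_left)
  rw [mem_closedBall_zero_iff] at hyR
  refine ⟨y, hyS, hyR.eq_of_not_lt fun hlt => hmax y hyS ?_, hy ⟨hx, by simpa using hR⟩⟩
  filter_upwards [self_mem_nhdsWithin, mem_nhdsWithin_of_mem_nhds
    (Metric.isOpen_ball.mem_nhds (mem_ball_zero_iff.2 hlt))] with z hzS hzR
  exact hy ⟨hzS, Metric.ball_subset_closedBall hzR⟩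

end MaximumPrinciple

section Transmission

/-- The line through `x` and the origin, parametrized by the signed distance to `x`, so that
the distance to the origin increases with the parameter. It is constant if `x = 0`. -/
noncomputable def radialLine {E : Type*} [NormedAddCommGroup E] [NormedSpace ℝ E] (x : E) (t : ℝ) :
    E :=
  x + t • NormedSpace.normalize x

section RadialLine

variable {E : Type*} [NormedAddCommGroup E] [NormedSpace ℝ E] {x : E}

@[simp]
theorem radialLine_zero (x : E) : radialLine x 0 = x := by simp [radialLine]

theorem hasDerivAt_radialLine (x : E) (t : ℝ) :
    HasDerivAt (radialLine x) (NormedSpace.normalize x) t :=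
  (((hasDerivAt_id t).smul_const _).const_add x).congr_deriv (one_smul ℝ _)

theorem continuous_radialLine (x : E) : Continuous (radialLine x) :=
  continuous_iff_continuousAt.2 fun t => (hasDerivAt_radialLine x t).continuousAt

theorem tendsto_radialLine (x : E) : Tendsto (radialLine x) (𝓝 0) (𝓝 x) :=
  (continuous_radialLine x).tendsto' _ _ (radialLine_zero x)

theorem norm_radialLine (hx : x ≠ 0) {t : ℝ} (ht : -‖x‖ ≤ t) : ‖radialLine x t‖ = ‖x‖ + t := by
  have hscale : radialLine x t = (‖x‖ + t) • NormedSpace.normalize x := by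
    rw [radialLine, add_smul, NormedSpace.norm_smul_normalize]
  rw [hscale, norm_smul, NormedSpace.norm_normalize hx, mul_one,
    Real.norm_of_nonneg (by linarith)]

theorem eventually_norm_radialLine_mem_Ioo_nhdsGT (hx : x ≠ 0) {r : ℝ} (hr : ‖x‖ < r) :
    ∀ᶠ t in 𝓝[>] (0 : ℝ), ‖radialLine x t‖ ∈ Ioo ‖x‖ r := by
  filter_upwards [Ioo_mem_nhdsGT (sub_pos.2 hr)] with t ht
  rw [norm_radialLine hx (by linarith [ht.1, norm_nonneg x])]
  constructor <;> linarith [ht.1, ht.2]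

theorem eventually_norm_radialLine_mem_Ioo_nhdsLT (hx : x ≠ 0) {r : ℝ} (hr : r < ‖x‖) :
    ∀ᶠ t in 𝓝[<] (0 : ℝ), ‖radialLine x t‖ ∈ Ioo r ‖x‖ := by
  filter_upwards [Ioo_mem_nhdsLT (sub_neg.2 hr), Ioo_mem_nhdsLT (neg_lt_zero.2 (norm_pos_iff.2 hx))]
    with t htr htx
  rw [norm_radialLine hx htx.1.le]
  constructor <;> linarith [htr.1, htr.2]

theorem continuousWithinAt_comp_radialLine {F : Type*} [TopologicalSpace F] {w : E → F} {S : Set E}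
    (hw : ContinuousWithinAt w S x) :
    ContinuousWithinAt (w ∘ radialLine x) (radialLine x ⁻¹' S) 0 :=
  hw.comp_of_eq (continuous_radialLine x).continuousWithinAt (mapsTo_preimage _ _)
    (radialLine_zero x)

section Comp

variable {F : Type*} [NormedAddCommGroup F] [NormedSpace ℝ F] {w : E → F} {a : F} {S : Set E}

theorem hasDerivAt_comp_radialLine {t : ℝ} (hw : DifferentiableAt ℝ w (radialLine x t)) :
    HasDerivAt (w ∘ radialLine x) (fderiv ℝ w (radialLine x t) (NormedSpace.normalize x)) t :=
  hw.hasFDerivAt.comp_hasDerivAt t (hasDerivAt_radialLine x t)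

theorem hasDerivWithinAt_Ici_comp_radialLine (hw : ContinuousWithinAt w S x)
    (hd : ∀ᶠ t in 𝓝[>] (0 : ℝ), radialLine x t ∈ S ∧ DifferentiableAt ℝ w (radialLine x t))
    (ha : Tendsto (fun t => fderiv ℝ w (radialLine x t) (NormedSpace.normalize x)) (𝓝[>] 0)
      (𝓝 a)) :
    HasDerivWithinAt (w ∘ radialLine x) a (Ici 0) 0 := by
  refine hasDerivWithinAt_Ici_of_tendsto_deriv (fun t ht => ?_)
    ((continuousWithinAt_comp_radialLine hw).mono fun t ht => ht.1) hd (ha.congr' ?_)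
  · exact (hasDerivAt_comp_radialLine ht.2).differentiableAt.differentiableWithinAt
  · exact hd.mono fun t ht => (hasDerivAt_comp_radialLine ht.2).deriv.symm

theorem hasDerivWithinAt_Iic_comp_radialLine (hw : ContinuousWithinAt w S x)
    (hd : ∀ᶠ t in 𝓝[<] (0 : ℝ), radialLine x t ∈ S ∧ DifferentiableAt ℝ w (radialLine x t))
    (ha : Tendsto (fun t => fderiv ℝ w (radialLine x t) (NormedSpace.normalize x)) (𝓝[<] 0)
      (𝓝 a)) :
    HasDerivWithinAt (w ∘ radialLine x) a (Iic 0) 0 := by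
  refine hasDerivWithinAt_Iic_of_tendsto_deriv (fun t ht => ?_)
    ((continuousWithinAt_comp_radialLine hw).mono fun t ht => ht.1) hd (ha.congr' ?_)
  · exact (hasDerivAt_comp_radialLine ht.2).differentiableAt.differentiableWithinAt
  · exact hd.mono fun t ht => (hasDerivAt_comp_radialLine ht.2).deriv.symm

end Comp

theorem hasDerivAt_norm_sq_radialLine {E : Type*} [NormedAddCommGroup E] [InnerProductSpace ℝ E]
    (x : E) : HasDerivAt (fun t => ‖radialLine x t‖ ^ 2) (2 * ‖x‖) 0 := by
  have hinner : ⟪x, NormedSpace.normalize x⟫_ℝ = ‖x‖ := by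
    rw [NormedSpace.normalize, real_inner_smul_right, real_inner_self_eq_norm_sq]
    rcases eq_or_ne ‖x‖ 0 with h | h
    · simp [h]
    · field_simp
  simpa [hinner] using (hasDerivAt_radialLine x 0).norm_sq

end RadialLine

/-- A continuous radial comparison function, strictly subharmonic off the circle of radius `r`,
which increases outwards and whose radial derivative jumps upwards across that circle. -/
noncomputable def barrier {E : Type*} [Norm E] (r : ℝ) (x : E) : ℝ :=
  max (‖x‖ ^ 2) (2 * ‖x‖ ^ 2 - r ^ 2)

section Barrier

variable {E : Type*} [SeminormedAddCommGroup E] {r : ℝ} {x : E}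

theorem continuous_barrier (r : ℝ) : Continuous (barrier r : E → ℝ) := by
  unfold barrier
  fun_prop

theorem barrier_nonneg (r : ℝ) (x : E) : 0 ≤ barrier r x :=
  le_max_of_le_left (sq_nonneg ‖x‖)

theorem barrier_of_le (h : ‖x‖ ≤ r) : barrier r x = ‖x‖ ^ 2 := by
  refine max_eq_left ?_
  nlinarith [norm_nonneg x]

theorem barrier_of_ge (hr : 0 ≤ r) (h : r ≤ ‖x‖) : barrier r x = 2 * ‖x‖ ^ 2 - r ^ 2 := by
  refine max_eq_right ?_
  nlinarith

theorem isLocalMaxOn_add_norm_sq_of_barrier {u : E → ℝ} {S : Set E} {ε : ℝ} (hε : 0 ≤ ε)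
    (h : IsLocalMaxOn (fun z => u z + ε * barrier r z) S x) (hx : ‖x‖ ≤ r) :
    IsLocalMaxOn (fun z => u z + ε * ‖z‖ ^ 2) S x := by
  filter_upwards [h] with z hz
  have hle : ε * ‖z‖ ^ 2 ≤ ε * barrier r z := mul_le_mul_of_nonneg_left (le_max_left _ _) hε
  rw [barrier_of_le hx] at hz
  linarith

theorem isLocalMaxOn_add_two_mul_norm_sq_of_barrier {u : E → ℝ} {S : Set E} {ε : ℝ} (hε : 0 ≤ ε)
    (h : IsLocalMaxOn (fun z => u z + ε * barrier r z) S x) (hr : 0 ≤ r) (hx : r ≤ ‖x‖) :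
    IsLocalMaxOn (fun z => u z + 2 * ε * ‖z‖ ^ 2) S x := by
  filter_upwards [h] with z hz
  have hle : ε * (2 * ‖z‖ ^ 2 - r ^ 2) ≤ ε * barrier r z :=
    mul_le_mul_of_nonneg_left (le_max_right _ _) hε
  rw [barrier_of_ge hr hx] at hz
  linarith

end Barrier

variable {E F : Type*} [NormedAddCommGroup E] [InnerProductSpace ℝ E] [FiniteDimensional ℝ E]
  [NormedAddCommGroup F] [NormedSpace ℝ F]

/-- The transmission problem outside the ball of radius `ri`: `w` is harmonic off the sphere of
radius `re`, its radial derivative vanishes on the sphere of radius `ri` and jumps by `g` across the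
sphere of radius `re`. Radial derivatives are one-sided derivatives along the ray through the
boundary point, so that `w` need not be differentiable on the two spheres. -/
structure IsTransmission (ri re : ℝ) (g w : E → F) : Prop where
  continuousOn : ContinuousOn w (Metric.ball 0 ri)ᶜ
  harmonicAt : ∀ x, ri < ‖x‖ → ‖x‖ ≠ re → HarmonicAt w x
  neumann : ∀ x, ‖x‖ = ri → HasDerivWithinAt (w ∘ radialLine x) 0 (Ici 0) 0
  jump : ∀ x, ‖x‖ = re → ∃ a b,
    HasDerivWithinAt (w ∘ radialLine x) a (Ici 0) 0 ∧
      HasDerivWithinAt (w ∘ radialLine x) b (Iic 0) 0 ∧ a - b = g x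

namespace IsTransmission

variable {ri re : ℝ} {g g' w w' : E → F} {f u : E → ℝ} {x : E} {ε : ℝ}

theorem clm_comp {G : Type*} [NormedAddCommGroup G] [NormedSpace ℝ G]
    (h : IsTransmission ri re g w) (L : F →L[ℝ] G) :
    IsTransmission ri re (L ∘ g) (L ∘ w) where
  continuousOn := L.continuous.comp_continuousOn h.continuousOn
  harmonicAt x hx hxe := (h.harmonicAt x hx hxe).comp_CLM L
  neumann x hx := by
    simpa [Function.comp_def] using L.hasFDerivAt.comp_hasDerivWithinAt 0 (h.neumann x hx)
  jump x hx := by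
    obtain ⟨a, b, ha, hb, hab⟩ := h.jump x hx
    exact ⟨L a, L b, L.hasFDerivAt.comp_hasDerivWithinAt 0 ha,
      L.hasFDerivAt.comp_hasDerivWithinAt 0 hb, by rw [← map_sub, hab, Function.comp_apply]⟩

theorem sub (h : IsTransmission ri re g w) (h' : IsTransmission ri re g' w') :
    IsTransmission ri re (g - g') (w - w') where
  continuousOn := h.continuousOn.sub h'.continuousOn
  harmonicAt x hx hxe := (h.harmonicAt x hx hxe).sub (h'.harmonicAt x hx hxe)
  neumann x hx := ((h.neumann x hx).sub (h'.neumann x hx)).congr_deriv (sub_zero 0)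
  jump x hx := by
    obtain ⟨a, b, ha, hb, hab⟩ := h.jump x hx
    obtain ⟨a', b', ha', hb', hab'⟩ := h'.jump x hx
    exact ⟨a - a', b - b', ha.sub ha', hb.sub hb', by
      rw [sub_sub_sub_comm, hab, hab', Pi.sub_apply]⟩

theorem congr_jump (h : IsTransmission ri re g w) (hg : ∀ x, ‖x‖ = re → g x = g' x) :
    IsTransmission ri re g' w where
  continuousOn := h.continuousOn
  harmonicAt := h.harmonicAt
  neumann := h.neumann
  jump x hx := hg x hx ▸ h.jump x hx

theorem not_isLocalMaxOn_of_norm_eq_inner (h : IsTransmission ri re f u) (hri : 0 < ri)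
    (hre : ri ≤ re) (hε : 0 < ε) (hx : ‖x‖ = ri) :
    ¬IsLocalMaxOn (fun z => u z + ε * barrier re z) (Metric.ball 0 ri)ᶜ x := by
  intro hmax
  have hx0 : x ≠ 0 := norm_pos_iff.1 (hx ▸ hri)
  have hray : Tendsto (radialLine x) (𝓝[≥] 0) (𝓝[(Metric.ball 0 ri)ᶜ] x) := by
    refine tendsto_nhdsWithin_iff.2 ⟨(tendsto_radialLine x).mono_left nhdsWithin_le_nhds, ?_⟩
    filter_upwards [self_mem_nhdsWithin] with t (ht : 0 ≤ t)
    simp only [mem_compl_iff, mem_ball_zero_iff, not_lt]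
    rw [norm_radialLine hx0 (by linarith), hx]
    linarith
  have hderiv := (h.neumann x hx).add
    ((hasDerivAt_norm_sq_radialLine x).hasDerivWithinAt.const_mul ε)
  have hmaxray :
      IsLocalMaxOn (fun t => u (radialLine x t) + ε * ‖radialLine x t‖ ^ 2) (Ici 0) 0 := by
    simpa [IsLocalMaxOn, IsMaxFilter] using
      hray.eventually (isLocalMaxOn_add_norm_sq_of_barrier hε.le hmax (hx.trans_le hre))
  have hnonpos := nonpos_of_isLocalMaxOn_Ici hmaxray hderiv
  rw [zero_add, hx] at hnonpos
  exact hnonpos.not_gt (by positivity)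

theorem not_isLocalMax_of_norm_eq_interface (h : IsTransmission ri re 0 u) (hre : 0 < re)
    (hε : 0 < ε) (hx : ‖x‖ = re) : ¬IsLocalMax (fun z => u z + ε * barrier re z) x := by
  intro hmax
  obtain ⟨a, b, ha, hb, hab⟩ := h.jump x hx
  obtain rfl := sub_eq_zero.1 hab
  have hu : HasDerivAt (u ∘ radialLine x) a 0 := by
    simpa using ha.union hb
  have hcritical {k : ℝ} (hk : IsLocalMax (fun z => u z + k * ‖z‖ ^ 2) x) :
      a + k * (2 * re) = 0 := by
    have hmaxline : IsLocalMax (fun t => u (radialLine x t) + k * ‖radialLine x t‖ ^ 2) 0 := by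
      simpa [IsLocalMax, IsMaxFilter] using (tendsto_radialLine x).eventually hk
    exact hmaxline.hasDerivAt_eq_zero
      (hu.add (hx ▸ (hasDerivAt_norm_sq_radialLine x).const_mul k))
  rw [← isLocalMaxOn_univ_iff] at hmax
  have hinner := hcritical (isLocalMaxOn_univ_iff.1
    (isLocalMaxOn_add_norm_sq_of_barrier hε.le hmax hx.le))
  have houter := hcritical (isLocalMaxOn_univ_iff.1
    (isLocalMaxOn_add_two_mul_norm_sq_of_barrier hε.le hmax hre.le hx.ge))
  have hpos : 0 < ε * re := by positivity
  linarith

theorem not_isLocalMax_of_norm_ne_interface (h : IsTransmission ri re f u) (hri : 0 ≤ ri)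
    (hre : 0 ≤ re) (hε : 0 < ε) (hx : ri < ‖x‖) (hxe : ‖x‖ ≠ re) :
    ¬IsLocalMax (fun z => u z + ε * barrier re z) x := by
  intro hmax
  have : Nontrivial E := ⟨x, 0, norm_pos_iff.1 (hri.trans_lt hx)⟩
  have hu := h.harmonicAt x hx hxe
  rw [← isLocalMaxOn_univ_iff] at hmax
  rcases hxe.lt_or_gt with hlt | hgt
  · exact not_isLocalMax_add_norm_sq hu hε (isLocalMaxOn_univ_iff.1
      (isLocalMaxOn_add_norm_sq_of_barrier hε.le hmax hlt.le))
  · exact not_isLocalMax_add_norm_sq hu (mul_pos two_pos hε) (isLocalMaxOn_univ_iff.1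
      (isLocalMaxOn_add_two_mul_norm_sq_of_barrier hε.le hmax hre hgt.le))

theorem not_isLocalMaxOn_add_barrier (h : IsTransmission ri re 0 u) (hri : 0 < ri) (hre : ri ≤ re)
    (hε : 0 < ε) (hx : ri ≤ ‖x‖) :
    ¬IsLocalMaxOn (fun z => u z + ε * barrier re z) (Metric.ball 0 ri)ᶜ x := by
  rcases hx.eq_or_lt with hxi | hxi
  · exact h.not_isLocalMaxOn_of_norm_eq_inner hri hre hε hxi.symm
  intro hmax
  have hnhds : (Metric.ball 0 ri)ᶜ ∈ 𝓝 x := by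
    filter_upwards [continuous_norm.continuousAt.eventually (lt_mem_nhds hxi)] with z hz
    simpa using hz.le
  by_cases hxe : ‖x‖ = re
  · exact h.not_isLocalMax_of_norm_eq_interface (hri.trans_le hre) hε hxe (hmax.isLocalMax hnhds)
  · exact h.not_isLocalMax_of_norm_ne_interface hri.le (hri.le.trans hre) hε hxi hxe
      (hmax.isLocalMax hnhds)

theorem nonpos_of_tendsto_zero (h : IsTransmission ri re 0 u) (hri : 0 < ri) (hre : ri ≤ re)
    (hu : Tendsto u (Bornology.cobounded E) (𝓝 0)) (hx : ri ≤ ‖x‖) : u x ≤ 0 := by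
  by_contra! hpos
  obtain ⟨R, hRx, hR⟩ : ∃ R, ‖x‖ ≤ R ∧ ∀ y, ‖y‖ = R → u y < u x / 2 := by
    have hev := hu.eventually (gt_mem_nhds (half_pos hpos))
    rw [← comap_norm_atTop, eventually_comap] at hev
    obtain ⟨R, hRx, hR⟩ := ((eventually_ge_atTop ‖x‖).and hev).exists
    exact ⟨R, hRx, hR⟩
  obtain ⟨M, hM, hMR⟩ : ∃ M > 0, ∀ y : E, ‖y‖ = R → barrier re y = M := by
    refine ⟨max (R ^ 2) (2 * R ^ 2 - re ^ 2), lt_max_of_lt_left ?_, fun y hy => by rw [barrier, hy]⟩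
    have : 0 < R := hri.trans_le (hx.trans hRx)
    positivity
  have hε : 0 < u x / (2 * M) := by positivity
  have hS : IsClosed (Metric.ball (0 : E) ri)ᶜ := Metric.isOpen_ball.isClosed_compl
  have hxS : x ∈ (Metric.ball (0 : E) ri)ᶜ := by simpa using hx
  obtain ⟨y, -, hyR, hxy⟩ := exists_norm_eq_le_of_not_isLocalMaxOn hS
    (h.continuousOn.add ((continuous_barrier re).const_mul (u x / (2 * M))).continuousOn)
    (fun y hy => h.not_isLocalMaxOn_add_barrier hri hre hε (by simpa using hy)) hxS hRx
  have hMε : u x / (2 * M) * M = u x / 2 := by field_simp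
  simp only [Pi.add_apply, hMR y hyR, hMε] at hxy
  linarith [hR y hyR, mul_nonneg hε.le (barrier_nonneg re x)]

theorem eq_zero_of_tendsto_zero (h : IsTransmission ri re 0 w) (hri : 0 < ri) (hre : ri ≤ re)
    (hw : Tendsto w (Bornology.cobounded E) (𝓝 0)) (hx : ri ≤ ‖x‖) : w x = 0 := by
  have hdual (L : F →L[ℝ] ℝ) : L (w x) ≤ 0 := by
    have hL : IsTransmission ri re 0 (L ∘ w) := (h.clm_comp L).congr_jump fun x _ => map_zero L
    exact hL.nonpos_of_tendsto_zero hri hre (by simpa using (L.continuous.tendsto 0).comp hw) hx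
  refine SeparatingDual.eq_zero_of_forall_dual_eq_zero (R := ℝ) fun L => ?_
  exact (hdual L).antisymm (by simpa using hdual (-L))

theorem eq_of_tendsto_sub (h : IsTransmission ri re g w) (h' : IsTransmission ri re g' w')
    (hri : 0 < ri) (hre : ri ≤ re) (hg : ∀ x, ‖x‖ = re → g x = g' x)
    (hw : Tendsto (fun x => w x - w' x) (Bornology.cobounded E) (𝓝 0)) (hx : ri ≤ ‖x‖) :
    w x = w' x := by
  have hsub : IsTransmission ri re 0 (w - w') :=
    (h.sub h').congr_jump fun x hx => sub_eq_zero.2 (hg x hx)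
  exact sub_eq_zero.1 (hsub.eq_zero_of_tendsto_zero hri hre hw hx)

end IsTransmission

end Transmission

section NormalDerivative

theorem mem_frontier_ball_zero_iff {E : Type*} [SeminormedAddCommGroup E] [NormedSpace ℝ E] {r : ℝ}
    (hr : r ≠ 0) {x : E} : x ∈ frontier (Metric.ball (0 : E) r) ↔ ‖x‖ = r := by
  rw [frontier_ball 0 hr, mem_sphere_zero_iff_norm]

theorem mem_compl_closure_ball_zero_iff {E : Type*} [SeminormedAddCommGroup E] [NormedSpace ℝ E]
    {r : ℝ} (hr : r ≠ 0) {x : E} : x ∈ (closure (Metric.ball (0 : E) r))ᶜ ↔ r < ‖x‖ := by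
  rw [closure_ball 0 hr, mem_compl_iff, mem_closedBall_zero_iff, not_le]

theorem mem_ball_zero_diff_closure_ball_iff {E : Type*} [SeminormedAddCommGroup E]
    [NormedSpace ℝ E] {r R : ℝ} (hr : r ≠ 0) {x : E} :
    x ∈ Metric.ball (0 : E) R \ closure (Metric.ball 0 r) ↔ ‖x‖ < R ∧ r < ‖x‖ := by
  rw [sdiff_eq, mem_inter_iff, mem_compl_closure_ball_zero_iff hr, mem_ball_zero_iff]

theorem radialNormal_eq_normalize (x : ℂ) : radialNormal x = NormedSpace.normalize x := by
  rw [radialNormal, NormedSpace.normalize, Complex.real_smul, Complex.ofReal_inv, div_eq_inv_mul]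

variable {f g w : ℂ → ℂ} {x a : ℂ} {ri re r : ℝ}

theorem hasOuterNormalDeriv_radialNormal_iff :
    HasOuterNormalDeriv f (radialNormal x) x a ↔
      Tendsto (fun t => fderiv ℝ f (radialLine x t) (NormedSpace.normalize x)) (𝓝[>] 0) (𝓝 a) := by
  rw [HasOuterNormalDeriv, radialNormal_eq_normalize]
  rfl

theorem hasInnerNormalDeriv_radialNormal_iff :
    HasInnerNormalDeriv f (radialNormal x) x a ↔
      Tendsto (fun t => fderiv ℝ f (radialLine x t) (NormedSpace.normalize x)) (𝓝[<] 0) (𝓝 a) := by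
  have hneg : 𝓝[<] (0 : ℝ) = map (fun t => -t) (𝓝[>] 0) := by simp
  simp only [HasInnerNormalDeriv, radialNormal_eq_normalize, hneg, tendsto_map'_iff,
    Function.comp_def, radialLine, neg_smul, sub_eq_add_neg]

theorem isTransmission_of_hasNormalDeriv (hri : 0 < ri) (hre : ri < re)
    (hw : ContinuousOn w (Metric.ball 0 ri)ᶜ)
    (hharm : ∀ x, ri < ‖x‖ → ‖x‖ ≠ re → HarmonicAt w x)
    (hneumann : ∀ x, ‖x‖ = ri → HasOuterNormalDeriv w (radialNormal x) x 0)
    (hjump : ∀ x, ‖x‖ = re → ∃ a b, HasOuterNormalDeriv w (radialNormal x) x a ∧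
      HasInnerNormalDeriv w (radialNormal x) x b ∧ a - b = g x) :
    IsTransmission ri re g w := by
  have hregular {y : ℂ} (h : ri < ‖y‖) (h' : ‖y‖ ≠ re) :
      y ∈ (Metric.ball 0 ri)ᶜ ∧ DifferentiableAt ℝ w y :=
    ⟨by simpa using h.le, (hharm y h h').1.differentiableAt (by simp)⟩
  refine ⟨hw, hharm, fun x hx => ?_, fun x hx => ?_⟩
  · have hx0 : x ≠ 0 := norm_pos_iff.1 (hx ▸ hri)
    refine hasDerivWithinAt_Ici_comp_radialLine (hw x (by simpa using hx.ge)) ?_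
      (hasOuterNormalDeriv_radialNormal_iff.1 (hneumann x hx))
    filter_upwards [eventually_norm_radialLine_mem_Ioo_nhdsGT hx0 (hx ▸ hre)] with t ht
    exact hregular (hx ▸ ht.1) ht.2.ne
  · have hx0 : x ≠ 0 := norm_pos_iff.1 (hx ▸ hri.trans hre)
    have hxw : ContinuousWithinAt w (Metric.ball 0 ri)ᶜ x := hw x (by simpa using hx ▸ hre.le)
    obtain ⟨a, b, ha, hb, hab⟩ := hjump x hx
    refine ⟨a, b, hasDerivWithinAt_Ici_comp_radialLine hxw ?_
      (hasOuterNormalDeriv_radialNormal_iff.1 ha), hasDerivWithinAt_Iic_comp_radialLine hxw ?_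
      (hasInnerNormalDeriv_radialNormal_iff.1 hb), hab⟩
    · filter_upwards [eventually_norm_radialLine_mem_Ioo_nhdsGT hx0 (lt_add_one ‖x‖)] with t ht
      exact hregular (hre.trans (hx ▸ ht.1)) (hx ▸ ht.1.ne')
    · filter_upwards [eventually_norm_radialLine_mem_Ioo_nhdsLT hx0 (hx ▸ hre : ri < ‖x‖)] with t ht
      exact hregular ht.1 (hx ▸ ht.2.ne)

theorem tendsto_fderiv_radialLine (hg : ContDiffAt ℝ 1 g x) :
    Tendsto (fun t => fderiv ℝ g (radialLine x t) (NormedSpace.normalize x)) (𝓝 0)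
      (𝓝 (fderiv ℝ g x (radialNormal x))) := by
  rw [radialNormal_eq_normalize]
  exact ((hg.fderiv_right (m := 0) (by simp)).continuousAt.clm_apply
    continuousAt_const).tendsto.comp (tendsto_radialLine x)

theorem hasOuterNormalDeriv_of_eqOn (hx : x ≠ 0) (hr : ‖x‖ < r) (hg : ContDiffAt ℝ 1 g x)
    (hfg : EqOn f g (norm ⁻¹' Ioo ‖x‖ r)) :
    HasOuterNormalDeriv f (radialNormal x) x (fderiv ℝ g x (radialNormal x)) := by
  refine hasOuterNormalDeriv_radialNormal_iff.2
    (((tendsto_fderiv_radialLine hg).mono_left nhdsWithin_le_nhds).congr' ?_)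
  filter_upwards [eventually_norm_radialLine_mem_Ioo_nhdsGT hx hr] with t ht
  rw [(hfg.eventuallyEq_of_mem ((isOpen_Ioo.preimage continuous_norm).mem_nhds ht)).fderiv_eq]

theorem hasInnerNormalDeriv_of_eqOn (hx : x ≠ 0) (hr : r < ‖x‖) (hg : ContDiffAt ℝ 1 g x)
    (hfg : EqOn f g (norm ⁻¹' Ioo r ‖x‖)) :
    HasInnerNormalDeriv f (radialNormal x) x (fderiv ℝ g x (radialNormal x)) := by
  refine hasInnerNormalDeriv_radialNormal_iff.2
    (((tendsto_fderiv_radialLine hg).mono_left nhdsWithin_le_nhds).congr' ?_)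
  filter_upwards [eventually_norm_radialLine_mem_Ioo_nhdsLT hx hr] with t ht
  rw [(hfg.eventuallyEq_of_mem ((isOpen_Ioo.preimage continuous_norm).mem_nhds ht)).fderiv_eq]

end NormalDerivative

theorem tendsto_sub_of_isBigO_inv_norm {E F : Type*} [SeminormedAddCommGroup E]
    [NormedAddCommGroup F] {f g h : E → F}
    (hf : (fun x => f x - h x) =O[Bornology.cobounded E] fun x => (‖x‖⁻¹ : ℝ))
    (hg : (fun x => g x - h x) =O[Bornology.cobounded E] fun x => (‖x‖⁻¹ : ℝ)) :
    Tendsto (fun x => f x - g x) (Bornology.cobounded E) (𝓝 0) := by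
  simpa using (hf.sub hg).trans_tendsto
    (tendsto_inv_atTop_zero.comp (tendsto_norm_cobounded_atTop (E := E)))

namespace IsAnnulusSolution

variable {n : ℕ} {ri re ζ₀ : ℝ} {φ φ' p p' : ℂ → ℂ} {x : ℂ}

theorem isTransmission_potential (h : IsAnnulusSolution n ri re ζ₀ φ p) (hri : 0 < ri)
    (hre : ri < re) : IsTransmission ri re 0 φ := by
  have hharm (x : ℂ) (hx : ri < ‖x‖) : HarmonicAt φ x :=
    h.potential_harmonic x ((mem_compl_closure_ball_zero_iff hri.ne').2 hx)
  refine isTransmission_of_hasNormalDeriv hri hre h.potential_continuous (fun x hx _ => hharm x hx)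
    (fun x hx => h.potential_insulation x ((mem_frontier_ball_zero_iff hri.ne').2 hx))
    fun x hx => ?_
  have hxi : ri < ‖x‖ := hx ▸ hre
  have hx0 : x ≠ 0 := norm_pos_iff.1 (hri.trans hxi)
  have hφ : ContDiffAt ℝ 1 φ x := (hharm x hxi).1.of_le (by norm_num)
  exact ⟨_, _, hasOuterNormalDeriv_of_eqOn hx0 (lt_add_one _) hφ (eqOn_refl _ _),
    hasInnerNormalDeriv_of_eqOn hx0 hxi hφ (eqOn_refl _ _), sub_self _⟩

theorem potential_eq (h : IsAnnulusSolution n ri re ζ₀ φ p)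
    (h' : IsAnnulusSolution n ri re ζ₀ φ' p') (hri : 0 < ri) (hre : ri < re) (hx : ri ≤ ‖x‖) :
    φ x = φ' x :=
  (h.isTransmission_potential hri hre).eq_of_tendsto_sub (h'.isTransmission_potential hri hre)
    hri hre.le (fun _ _ => rfl)
    (tendsto_sub_of_isBigO_inv_norm h.potential_infinity h'.potential_infinity) hx

theorem isTransmission_pressure (h : IsAnnulusSolution n ri re ζ₀ φ p) (hri : 0 < ri)
    (hre : ri < re) :
    IsTransmission ri re (fun x => 12 * ζ₀ * fderiv ℝ φ x (radialNormal x)) p := by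
  have hre0 := hri.trans hre
  refine isTransmission_of_hasNormalDeriv hri hre h.pressure_continuous (fun x hx hxe => ?_)
    (fun x hx => h.pressure_no_penetration x ((mem_frontier_ball_zero_iff hri.ne').2 hx))
    fun x hx => h.pressure_jump x ((mem_frontier_ball_zero_iff hre0.ne').2 hx)
  rcases hxe.lt_or_gt with hlt | hgt
  · exact h.pressure_harmonic_inside x ((mem_ball_zero_diff_closure_ball_iff hri.ne').2 ⟨hlt, hx⟩)
  · exact h.pressure_harmonic_outside x ((mem_compl_closure_ball_zero_iff hre0.ne').2 hgt)

theorem pressure_eq (h : IsAnnulusSolution n ri re ζ₀ φ p)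
    (h' : IsAnnulusSolution n ri re ζ₀ φ' p') (hri : 0 < ri) (hre : ri < re) (hx : ri ≤ ‖x‖) :
    p x = p' x := by
  refine (h.isTransmission_pressure hri hre).eq_of_tendsto_sub (h'.isTransmission_pressure hri hre)
    hri hre.le (fun x hx => ?_)
    (tendsto_sub_of_isBigO_inv_norm h.pressure_infinity h'.pressure_infinity) hx
  have hφ : φ =ᶠ[𝓝 x] φ' := by
    filter_upwards [continuous_norm.continuousAt.eventually (lt_mem_nhds (hx ▸ hre : ri < ‖x‖))]
      with y hy using h.potential_eq h' hri hre hy.le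
  rw [hφ.fderiv_eq]

end IsAnnulusSolution

section ExplicitSolution

theorem polarHarmonic_eq_pow (n : ℕ) (x : ℂ) : polarHarmonic n x = x ^ n := by
  conv_rhs => rw [← Complex.norm_mul_exp_arg_mul_I x]
  rw [polarHarmonic, mul_pow, ← Complex.exp_nat_mul]
  ring_nf

/-- The separated harmonic field `(α r ^ n + β r ^ (-n)) exp (i n θ)`; since
`r ^ (-n) exp (i n θ)` is the complex conjugate of `x ^ (-n)`, no polar coordinates are needed. -/
noncomputable def annularField (n : ℕ) (α β x : ℂ) : ℂ :=
  α * x ^ n + β * (starRingEnd ℂ) (x ^ n)⁻¹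

section AnnularField

variable {x : ℂ}

theorem annularField_eq (n : ℕ) (α β : ℂ) (hx : x ≠ 0) :
    annularField n α β x = (α + β / (‖x‖ : ℂ) ^ (2 * n)) * x ^ n := by
  have hconj : (starRingEnd ℂ) x ≠ 0 := by simpa using hx
  rw [annularField, add_mul, pow_mul, ← Complex.mul_conj', map_inv₀, map_pow, mul_pow]
  field_simp

theorem harmonicAt_annularField (n : ℕ) (α β : ℂ) (hx : x ≠ 0) :
    HarmonicAt (annularField n α β) x := by
  have hpow : HarmonicAt (fun x : ℂ => α * x ^ n) x :=
    (analyticAt_const.mul (analyticAt_id.pow n)).harmonicAt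
  have hinv : HarmonicAt (fun x : ℂ => (x ^ n)⁻¹) x :=
    ((analyticAt_id.pow n).inv (pow_ne_zero n hx)).harmonicAt
  exact hpow.add ((hinv.comp_CLM (Complex.conjCLE : ℂ →L[ℝ] ℂ)).comp_CLM
    (ContinuousLinearMap.mul ℝ ℂ β))

theorem continuousOn_annularField (n : ℕ) (α β : ℂ) : ContinuousOn (annularField n α β) {0}ᶜ :=
  fun _ hx => (harmonicAt_annularField n α β hx).1.continuousAt.continuousWithinAt

theorem fderiv_zpow_radialNormal (m : ℤ) (hx : x ≠ 0) :
    fderiv ℝ (fun z : ℂ => z ^ m) x (radialNormal x) = m / ‖x‖ * x ^ m := by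
  rw [(hasDerivAt_zpow m x (Or.inl hx)).complexToReal_fderiv.fderiv, radialNormal,
    zpow_sub_one₀ hx, smul_apply, one_apply_eq_self, smul_eq_mul]
  field_simp

theorem fderiv_annularField_radialNormal (n : ℕ) (α β : ℂ) (hx : x ≠ 0) :
    fderiv ℝ (annularField n α β) x (radialNormal x) = n / ‖x‖ * annularField n α (-β) x := by
  have hzpow (m : ℤ) : HasFDerivAt (fun z : ℂ => z ^ m) (fderiv ℝ (fun z : ℂ => z ^ m) x) x :=
    (hasDerivAt_zpow m x (Or.inl hx)).complexToReal_fderiv.differentiableAt.hasFDerivAt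
  have hfield : HasFDerivAt
      (fun z : ℂ => α * z ^ (n : ℤ) + β * (starRingEnd ℂ) (z ^ (-n : ℤ))) _ x :=
    ((hzpow n).const_mul α).add
      ((Complex.conjCLE.hasFDerivAt.comp x (hzpow (-n))).const_mul β)
  have hzpow_form : annularField n α β =
      fun z => α * z ^ (n : ℤ) + β * (starRingEnd ℂ) (z ^ (-n : ℤ)) := by
    simp only [zpow_neg, zpow_natCast]
    rfl
  rw [hzpow_form, hfield.fderiv]
  simp only [add_apply, smul_apply, ContinuousLinearMap.comp_apply, ContinuousLinearEquiv.coe_coe,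
    Complex.conjCLE_apply, fderiv_zpow_radialNormal _ hx, annularField]
  simp only [map_mul, map_div₀, map_neg, map_natCast, Complex.conj_ofReal, zpow_neg,
    zpow_natCast, Int.cast_neg, Int.cast_natCast, smul_eq_mul]
  ring

theorem isBigO_annularField_sub {n : ℕ} (hn : 1 ≤ n) (α β : ℂ) :
    (fun x => annularField n α β x - α * polarHarmonic n x) =O[Bornology.cobounded ℂ]
      fun x => (‖x‖⁻¹ : ℝ) := by
  refine IsBigO.of_bound ‖β‖ ?_
  filter_upwards [tendsto_norm_cobounded_atTop.eventually_ge_atTop 1] with x hx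
  rw [polarHarmonic_eq_pow, annularField, add_sub_cancel_left, norm_mul, RCLike.norm_conj,
    norm_inv, norm_pow, norm_inv, norm_norm]
  gcongr
  exact le_self_pow₀ hx (by lia)

/-- The separated field with leading coefficient `α` whose normal derivative vanishes on the circle
of radius `r`: there the radial derivatives of `ρ ^ n` and `r ^ (2 n) ρ ^ (-n)` cancel. -/
noncomputable def insulatedField (n : ℕ) (r : ℝ) (α : ℂ) : ℂ → ℂ :=
  annularField n α (α * (r : ℂ) ^ (2 * n))

theorem fderiv_insulatedField_norm_radialNormal (n : ℕ) (α : ℂ) (hx : x ≠ 0) :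
    fderiv ℝ (insulatedField n ‖x‖ α) x (radialNormal x) = 0 := by
  have hnorm : (‖x‖ : ℂ) ^ (2 * n) ≠ 0 := pow_ne_zero _ (by simpa using hx)
  rw [insulatedField, fderiv_annularField_radialNormal n _ _ hx, annularField_eq n _ _ hx, neg_div,
    mul_div_cancel_right₀ α hnorm, add_neg_cancel, zero_mul, mul_zero]

end AnnularField

/-- The coefficient of `r ^ n exp (i n θ)` in the pressure between the circles, as dictated by the
two matching conditions on the circle of radius `re`. -/
noncomputable def innerCoeff (n : ℕ) (ri re ζ₀ : ℝ) : ℝ :=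
  12 - 6 * ζ₀ * (re ^ (2 * n) - ri ^ (2 * n)) / re ^ (2 * n)

/-- The coefficient of `r ^ (-n) exp (i n θ)` in the pressure outside the circle of radius `re`,
as dictated by the two matching conditions on that circle. -/
noncomputable def outerCoeff (n : ℕ) (ri re ζ₀ : ℝ) : ℝ :=
  innerCoeff n ri re ζ₀ * (re ^ (2 * n) + ri ^ (2 * n)) - 12 * re ^ (2 * n)

/-- The pressure obtained by separation of variables, for the zeta potential `ζ₀`. The value
prescribed at `‖x‖ = re` is immaterial, since the two pieces agree there. -/
noncomputable def annulusPressure (n : ℕ) (ri re ζ₀ : ℝ) (x : ℂ) : ℂ :=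
  if ‖x‖ < re then insulatedField n ri (innerCoeff n ri re ζ₀) x
  else annularField n 12 (outerCoeff n ri re ζ₀) x

variable {n : ℕ} {ri re ζ₀ : ℝ} {x : ℂ}

theorem sub_outerCoeff_sub_innerCoeff_mul (hre : re ≠ 0) :
    12 * re ^ (2 * n) - outerCoeff n ri re ζ₀ -
      innerCoeff n ri re ζ₀ * (re ^ (2 * n) - ri ^ (2 * n)) =
        12 * ζ₀ * (re ^ (2 * n) - ri ^ (2 * n)) := by
  rw [outerCoeff, innerCoeff]
  field_simp
  ring

theorem outerCoeff_eq_zero (hn : 1 ≤ n) (hri : 0 ≤ ri) (hre : ri < re)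
    (hζ : ζ₀ = 2 * ri ^ (2 * n) * re ^ (2 * n) / (re ^ (4 * n) - ri ^ (4 * n))) :
    outerCoeff n ri re ζ₀ = 0 := by
  have hre0 := hri.trans_lt hre
  have hsub : re ^ (2 * n) - ri ^ (2 * n) ≠ 0 :=
    sub_ne_zero.2 (pow_lt_pow_left₀ hre hri (by lia)).ne'
  have hfactor : re ^ (4 * n) - ri ^ (4 * n) =
      (re ^ (2 * n) + ri ^ (2 * n)) * (re ^ (2 * n) - ri ^ (2 * n)) := by ring
  rw [outerCoeff, innerCoeff, hζ, hfactor]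
  field_simp
  ring

theorem innerCoeff_eq_zero (hn : 1 ≤ n) (hri : 0 ≤ ri) (hre : ri < re)
    (hζ : ζ₀ = 2 * re ^ (2 * n) / (re ^ (2 * n) - ri ^ (2 * n))) :
    innerCoeff n ri re ζ₀ = 0 := by
  have hre0 := hri.trans_lt hre
  have hsub : re ^ (2 * n) - ri ^ (2 * n) ≠ 0 :=
    sub_ne_zero.2 (pow_lt_pow_left₀ hre hri (by lia)).ne'
  rw [innerCoeff, hζ]
  field_simp
  ring

theorem annulusPressure_of_lt (h : ‖x‖ < re) :
    annulusPressure n ri re ζ₀ x = insulatedField n ri (innerCoeff n ri re ζ₀) x :=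
  if_pos h

theorem annulusPressure_of_ge (h : re ≤ ‖x‖) :
    annulusPressure n ri re ζ₀ x = annularField n 12 (outerCoeff n ri re ζ₀) x :=
  if_neg h.not_gt

theorem harmonicAt_annulusPressure (hx : x ≠ 0) (hxe : ‖x‖ ≠ re) :
    HarmonicAt (annulusPressure n ri re ζ₀) x := by
  rcases hxe.lt_or_gt with hlt | hgt
  · have heq : annulusPressure n ri re ζ₀ =ᶠ[𝓝 x] insulatedField n ri (innerCoeff n ri re ζ₀) := by
      filter_upwards [continuous_norm.continuousAt.eventually (gt_mem_nhds hlt)] with y hy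
        using annulusPressure_of_lt hy
    exact (harmonicAt_congr_nhds heq).2 (harmonicAt_annularField n _ _ hx)
  · have heq : annulusPressure n ri re ζ₀ =ᶠ[𝓝 x] annularField n 12 (outerCoeff n ri re ζ₀) := by
      filter_upwards [continuous_norm.continuousAt.eventually (lt_mem_nhds hgt)] with y hy
        using annulusPressure_of_ge hy.le
    exact (harmonicAt_congr_nhds heq).2 (harmonicAt_annularField n _ _ hx)

theorem continuousOn_annulusPressure (hre : 0 < re) :
    ContinuousOn (annulusPressure n ri re ζ₀) {0}ᶜ := by
  refine ContinuousOn.if ?_ ((continuousOn_annularField n _ _).mono inter_subset_left)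
    ((continuousOn_annularField n _ _).mono inter_subset_left)
  rintro x ⟨hx0, hx⟩
  obtain rfl : ‖x‖ = re := frontier_lt_subset_eq continuous_norm continuous_const hx
  have hnorm : (‖x‖ : ℂ) ≠ 0 := by simpa using hx0
  rw [insulatedField, annularField_eq n _ _ hx0, annularField_eq n _ _ hx0, outerCoeff]
  push_cast
  field_simp
  ring

theorem hasOuterNormalDeriv_annulusPressure_inner (hri : 0 < ri) (hre : ri < re) (hx : ‖x‖ = ri) :
    HasOuterNormalDeriv (annulusPressure n ri re ζ₀) (radialNormal x) x 0 := by
  subst hx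
  have hx0 := norm_pos_iff.1 hri
  rw [← fderiv_insulatedField_norm_radialNormal n (innerCoeff n ‖x‖ re ζ₀) hx0]
  exact hasOuterNormalDeriv_of_eqOn hx0 hre
    ((harmonicAt_annularField n _ _ hx0).1.of_le (by norm_num))
    fun y hy => annulusPressure_of_lt hy.2

theorem annulusPressure_jump (hri : 0 < ri) (hre : ri < re) (hx : ‖x‖ = re) :
    ∃ a b : ℂ, HasOuterNormalDeriv (annulusPressure n ri re ζ₀) (radialNormal x) x a ∧
      HasInnerNormalDeriv (annulusPressure n ri re ζ₀) (radialNormal x) x b ∧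
      a - b = 12 * ζ₀ * fderiv ℝ (insulatedField n ri 1) x (radialNormal x) := by
  subst hx
  have hx0 := norm_pos_iff.1 (hri.trans hre)
  have hC1 (α β : ℂ) : ContDiffAt ℝ 1 (annularField n α β) x :=
    (harmonicAt_annularField n α β hx0).1.of_le (by norm_num)
  refine ⟨_, _, hasOuterNormalDeriv_of_eqOn hx0 (lt_add_one _) (hC1 _ _)
    fun y hy => annulusPressure_of_ge hy.1.le, hasInnerNormalDeriv_of_eqOn hx0 hre (hC1 _ _)
    fun y hy => annulusPressure_of_lt hy.2, ?_⟩
  have hnorm : (‖x‖ : ℂ) ≠ 0 := by simpa using hx0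
  have hjump : (12 * ‖x‖ ^ (2 * n) - outerCoeff n ri ‖x‖ ζ₀ -
      innerCoeff n ri ‖x‖ ζ₀ * (‖x‖ ^ (2 * n) - ri ^ (2 * n)) : ℂ) =
        12 * ζ₀ * (‖x‖ ^ (2 * n) - ri ^ (2 * n)) := by
    exact_mod_cast sub_outerCoeff_sub_innerCoeff_mul (hri.trans hre).ne'
  simp only [insulatedField, fderiv_annularField_radialNormal n _ _ hx0, annularField_eq n _ _ hx0]
  field_simp
  linear_combination (n : ℂ) * hjump

theorem isAnnulusSolution_insulatedField_annulusPressure (hn : 1 ≤ n) (hri : 0 < ri)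
    (hre : ri < re) :
    IsAnnulusSolution n ri re ζ₀ (insulatedField n ri 1) (annulusPressure n ri re ζ₀) := by
  have hre0 := hri.trans hre
  have hne {y : ℂ} (hy : ri ≤ ‖y‖) : y ≠ 0 := norm_pos_iff.1 (hri.trans_le hy)
  have hsub : (Metric.ball (0 : ℂ) ri)ᶜ ⊆ {0}ᶜ := by simpa using hri
  constructor
  case potential_harmonic =>
    exact fun x hx => harmonicAt_annularField n _ _
      (hne ((mem_compl_closure_ball_zero_iff hri.ne').1 hx).le)
  case potential_continuous => exact (continuousOn_annularField n _ _).mono hsub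
  case potential_insulation =>
    intro x hx
    obtain rfl := (mem_frontier_ball_zero_iff hri.ne').1 hx
    rw [← fderiv_insulatedField_norm_radialNormal n 1 (hne le_rfl)]
    exact hasOuterNormalDeriv_of_eqOn (hne le_rfl) (lt_add_one _)
      ((harmonicAt_annularField n _ _ (hne le_rfl)).1.of_le (by norm_num)) (eqOn_refl _ _)
  case potential_infinity =>
    simpa [insulatedField] using isBigO_annularField_sub hn 1 (1 * (ri : ℂ) ^ (2 * n))
  case pressure_harmonic_inside =>
    intro x hx
    obtain ⟨hxe, hxi⟩ := (mem_ball_zero_diff_closure_ball_iff hri.ne').1 hx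
    exact harmonicAt_annulusPressure (hne hxi.le) hxe.ne
  case pressure_harmonic_outside =>
    intro x hx
    have hxe := (mem_compl_closure_ball_zero_iff hre0.ne').1 hx
    exact harmonicAt_annulusPressure (hne (hre.trans hxe).le) hxe.ne'
  case pressure_continuous => exact (continuousOn_annulusPressure hre0).mono hsub
  case pressure_no_penetration =>
    exact fun x hx => hasOuterNormalDeriv_annulusPressure_inner hri hre
      ((mem_frontier_ball_zero_iff hri.ne').1 hx)
  case pressure_jump =>
    exact fun x hx => annulusPressure_jump hri hre ((mem_frontier_ball_zero_iff hre0.ne').1 hx)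
  case pressure_infinity =>
    refine (isBigO_annularField_sub hn 12 (outerCoeff n ri re ζ₀)).congr' ?_ EventuallyEq.rfl
    filter_upwards [tendsto_norm_cobounded_atTop.eventually_ge_atTop re] with x hx
    rw [annulusPressure_of_ge hx]

end ExplicitSolution

theorem planeGrad_congr {f g : ℂ → ℂ} {x : ℂ} (h : f =ᶠ[𝓝 x] g) :
    planeGrad f x = planeGrad g x := by
  rw [planeGrad, planeGrad, h.fderiv_eq]

theorem averageVelocity_eq_of_eqOn_compl_closure {D Ω : Set ℂ} {ζ₀ : ℝ} {φ p P : ℂ → ℂ} {x : ℂ}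
    (h : EqOn p P (closure Ω)ᶜ) (hx : x ∈ (closure Ω)ᶜ) :
    averageVelocity D Ω ζ₀ φ p x = -((1 / 12 : ℂ) • planeGrad P x) := by
  have hζ : x ∉ Ω \ closure D := fun hx' => hx (subset_closure hx'.1)
  rw [averageVelocity, zetaMean, indicator_of_notMem hζ,
    planeGrad_congr (h.eventuallyEq_of_mem (isClosed_closure.isOpen_compl.mem_nhds hx)),
    Complex.ofReal_zero, zero_smul, sub_zero]

theorem hydrodynamicForce_eq_zero {D : Set ℂ} {ν p : ℂ → ℂ} (h : ∀ x ∈ frontier D, p x = 0) :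
    hydrodynamicForce D ν p = 0 := by
  rw [hydrodynamicForce, setIntegral_congr_fun (g := fun _ => 0) isClosed_frontier.measurableSet,
    integral_zero]
  intro x hx
  simp [stressTensor, h x hx]

namespace IsAnnulusSolution

variable {n : ℕ} {ri re ζ₀ : ℝ} {φ p : ℂ → ℂ} {x : ℂ}

theorem pressure_eq_of_outerCoeff_eq_zero (h : IsAnnulusSolution n ri re ζ₀ φ p) (hn : 1 ≤ n)
    (hri : 0 < ri) (hre : ri < re) (hc : outerCoeff n ri re ζ₀ = 0) (hx : re ≤ ‖x‖) :
    p x = 12 * polarHarmonic n x := by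
  rw [h.pressure_eq (isAnnulusSolution_insulatedField_annulusPressure hn hri hre) hri hre
    (hre.le.trans hx), annulusPressure_of_ge hx, hc, polarHarmonic_eq_pow]
  simp [annularField]

theorem pressure_eq_zero_of_innerCoeff_eq_zero (h : IsAnnulusSolution n ri re ζ₀ φ p)
    (hn : 1 ≤ n) (hri : 0 < ri) (hre : ri < re) (hc : innerCoeff n ri re ζ₀ = 0)
    (hxi : ri ≤ ‖x‖) (hxe : ‖x‖ < re) : p x = 0 := by
  rw [h.pressure_eq (isAnnulusSolution_insulatedField_annulusPressure hn hri hre) hri hre hxi,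
    annulusPressure_of_lt hxe, hc]
  simp [insulatedField, annularField]

end IsAnnulusSolution

theorem mainTheorem1 (n : ℕ) (hn : 1 ≤ n) (ri re : ℝ) (hri : 0 < ri) (hre : ri < re) :
    -- perfect cloaking
    (∀ ζ₀ : ℝ, ζ₀ = 2 * ri ^ (2 * n) * re ^ (2 * n) / (re ^ (4 * n) - ri ^ (4 * n)) →
      (∃ φ p : ℂ → ℂ, IsAnnulusSolution n ri re ζ₀ φ p) ∧
      ∀ φ p : ℂ → ℂ, IsAnnulusSolution n ri re ζ₀ φ p →
        (∀ x ∈ (closure (Metric.ball (0 : ℂ) re))ᶜ, p x = 12 * polarHarmonic n x) ∧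
        (∀ x ∈ (closure (Metric.ball (0 : ℂ) re))ᶜ,
          averageVelocity (Metric.ball 0 ri) (Metric.ball 0 re) ζ₀ φ p x =
            -((1 / 12 : ℂ) • planeGrad (fun y => 12 * polarHarmonic n y) x))) ∧
    -- perfect shielding
    (∀ ζ₀ : ℝ, ζ₀ = 2 * re ^ (2 * n) / (re ^ (2 * n) - ri ^ (2 * n)) →
      (∃ φ p : ℂ → ℂ, IsAnnulusSolution n ri re ζ₀ φ p) ∧
      ∀ φ p : ℂ → ℂ, IsAnnulusSolution n ri re ζ₀ φ p →
        (∀ x ∈ Metric.ball (0 : ℂ) re \ closure (Metric.ball (0 : ℂ) ri), p x = 0) ∧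
        hydrodynamicForce (Metric.ball 0 ri) radialNormal p = 0) := by
  have hsol (ζ₀ : ℝ) := isAnnulusSolution_insulatedField_annulusPressure (ζ₀ := ζ₀) hn hri hre
  refine ⟨fun ζ₀ hζ => ⟨⟨_, _, hsol ζ₀⟩, fun φ p h => ?_⟩,
    fun ζ₀ hζ => ⟨⟨_, _, hsol ζ₀⟩, fun φ p h => ?_⟩⟩
  · have hp : EqOn p (fun x => 12 * polarHarmonic n x) (closure (Metric.ball 0 re))ᶜ := fun x hx =>
      h.pressure_eq_of_outerCoeff_eq_zero hn hri hre (outerCoeff_eq_zero hn hri.le hre hζ)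
        ((mem_compl_closure_ball_zero_iff (hri.trans hre).ne').1 hx).le
    exact ⟨hp, fun x hx => averageVelocity_eq_of_eqOn_compl_closure hp hx⟩
  · have hp {x : ℂ} (hxi : ri ≤ ‖x‖) (hxe : ‖x‖ < re) : p x = 0 :=
      h.pressure_eq_zero_of_innerCoeff_eq_zero hn hri hre
        (innerCoeff_eq_zero hn hri.le hre hζ) hxi hxe
    refine ⟨fun x hx => ?_, hydrodynamicForce_eq_zero fun x hx => ?_⟩
    · obtain ⟨hxe, hxi⟩ := (mem_ball_zero_diff_closure_ball_iff hri.ne').1 hx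
      exact hp hxi.le hxe
    · have hxi := (mem_frontier_ball_zero_iff hri.ne').1 hx
      exact hp hxi.ge (hxi ▸ hre)
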